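/- **Definitions.** Let $D,K$ be nonempty sets, $F$ a nonempty set of functions $f:D\to K$, $G$ a normed space and $S:F\to G$ a mapping. For $m\in\mathbb N=\{1,2,\dots\}$ let $H_m=(\mathbb C^2)^{\otimes m}$ be the state space of $m$ qubits with canonical basis $|i\rangle$, $0\le i<2^m$. A *quantum query* is a tuple $Q=(m,m',m'',Z,\tau,\beta)$ with $m,m',m''\in\mathbb N$, $m'+m''\le m$, $\emptyset\ne Z\subseteq\{0,\dots,2^{m'}-1\}$, and arbitrary maps $\tau:Z\to D$, $\beta:K\to\{0,\dots,2^{m''}-1\}$. For $f:D\to K$ it defines the unitary operator $Q_f$ on $H_m=H_{m'}\otimes H_{m''}\otimes H_{m-m'-m''}$ by $Q_f|i\rangle|x\rangle|y\rangle=|i\rangle|x\oplus\beta(f(\tau(i)))\rangle|y\rangle$ if $i\in Z$ and $Q_f|i\rangle|x\rangle|y\rangle=|i\rangle|x\rangle|y\rangle$ otherwise, where $\oplus$ is addition modulo $2^{m''}$. A *quantum algorithm without measurement*, with $n\ge 0$ queries, consists of a query $Q$ and unitary operators $U_0,\dots,U_n$ on $H_m$; put $A_f=U_nQ_fU_{n-1}\cdots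 U_1Q_fU_0$. A *quantum algorithm* $A$ from $F$ to $G$ consists of finitely many ($k\ge1$) algorithms without measurement $A_0,\dots,A_{k-1}$ (on $m_0,\dots,m_{k-1}$ qubits), of functions $b_\ell=b_\ell(x_0,\dots,x_{\ell-1})\in\{0,\dots,2^{m_\ell}-1\}$ of the earlier measurement results ($b_0$ being a constant), and of a map $\varphi$ from the tuples $(x_0,\dots,x_{k-1})$ of results to $G$. On input $f$ the results $(x_0,\dots,x_{k-1})$ occur with probability $\prod_{\ell<k}|\langle x_\ell|A_{\ell,f}|b_\ell(x_0,\dots,x_{\ell-1})\rangle|^2$, and the output $A(f)$ is the random element $\varphi(x_0,\dots,x_{k-1})$. The number of queries of $A$ is the sum of those of $A_0,\dots,A_{k-1}$. The error of $A$ is $e(S,A,F)=\sup_{f\in F}\inf\{\varepsilon\ge0:\mathbb P\{\|S(f)-A(f)\|>\varepsilon\}\le 1/4\}$, and the *$n$-th minimal quantum error* $e_n^{q}(S,F)$ is the infimum of $e(S,A,F)$ over all quantum algorithms $A$ from $F$ to $G$ with at most $n$ queries. (The superscript $q$ stands for "quantum" and is unrelated to the exponent $q$ below.) For $1\le p\le\infty$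 and $r,d\in\mathbb N$ let $W_p^r([0,1]^d)$ be the space of real functions $f\in L_p([0,1]^d)$ whose weak partial derivatives $\partial^\alpha f$ with $|\alpha|\le r$ all belong to $L_p([0,1]^d)$, with norm $\big(\sum_{|\alpha|\le r}\|\partial^\alpha f\|_{L_p}^p\big)^{1/p}$ if $p<\infty$ and $\max_{|\alpha|\le r}\|\partial^\alpha f\|_{L_\infty}$ if $p=\infty$. If $r/d>1/p$, every element of this space has a unique continuous representative and is identified with it, so that the unit ball $\mathcal B(W_p^r([0,1]^d))$ is a set of functions from $D=[0,1]^d$ to $K=\mathbb R$. **Corollary.** Let $1\le p,q\le\infty$, let $r,d\in\mathbb N$, and assume $\frac rd>\max\left(\frac1p,\frac2p-\frac2q\right)$ (with $1/\infty=0$). Let $J_{pq}:W_p^r([0,1]^d)\to L_q([0,1]^d)$, $J_{pq}f=f$, be the embedding. Then there is a constant $c>0$ such that for all $n\in\mathbb N$ $$e_n^{q}\big(J_{pq},\mathcal B(W_p^r([0,1]^d))\big)\ge c\,n^{-r/d}.$$ -/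

import Mathlib

open MeasureTheory Set
open scoped ENNReal NNReal

noncomputable section

namespace QuantumIBC

/-! ### The quantum setting of information-based complexity -/

/-- A quantum query on functions `f : D → K`: a tuple `(m, m', m'', Z, τ, β)`, where
`m', m'' ≥ 1`, `m' + m'' ≤ m`, `∅ ≠ Z ⊆ {0, …, 2 ^ m' - 1}`, `τ : Z → D` and
`β : K → {0, …, 2 ^ m'' - 1}`. Here `m`, `m'`, `m''` are `qubits`, `argQubits`, `valQubits`. -/
structure Query (D K : Type) where
  qubits : ℕ
  argQubits : ℕ
  valQubits : ℕ
  argQubits_pos : 0 < argQubits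
  valQubits_pos : 0 < valQubits
  add_le : argQubits + valQubits ≤ qubits
  Z : Set (Fin (2 ^ argQubits))
  Z_nonempty : Z.Nonempty
  τ : Z → D
  β : K → Fin (2 ^ valQubits)

/-- The labels `(i, x, y)` of the canonical basis `|i⟩ ⊗ |x⟩ ⊗ |y⟩` of the state space
`H_m = H_{m'} ⊗ H_{m''} ⊗ H_{m - m' - m''}` of `m` qubits (there are `2 ^ m` of them). Linear
operators on `H_m` are given by their matrices in this basis. -/
abbrev Query.Label {D K : Type} (Q : Query D K) : Type :=
  Fin (2 ^ Q.argQubits) × Fin (2 ^ Q.valQubits) × Fin (2 ^ (Q.qubits - Q.argQubits - Q.valQubits))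

open Classical in
/-- The action of the query on basis states:
`|i⟩|x⟩|y⟩ ↦ |i⟩|x ⊕ β(f(τ(i)))⟩|y⟩` if `i ∈ Z`, and `|i⟩|x⟩|y⟩ ↦ |i⟩|x⟩|y⟩` otherwise,
where `⊕` is addition modulo `2 ^ m''`. -/
def Query.act {D K : Type} (Q : Query D K) (f : D → K) (s : Q.Label) : Q.Label :=
  if h : s.1 ∈ Q.Z then (s.1, s.2.1 + Q.β (f (Q.τ ⟨s.1, h⟩)), s.2.2) else s

/-- The matrix of the operator `Q_f` in the canonical basis. -/
def Query.op {D K : Type} (Q : Query D K) (f : D → K) : Matrix Q.Label Q.Label ℂ :=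
  Matrix.of fun a b => if a = Q.act f b then 1 else 0

/-- A quantum algorithm without measurement: a query `Q` together with unitary operators
`U_0, …, U_n` on the state space of `Q`; the number of queries is `n`. -/
structure Circuit (D K : Type) where
  query : Query D K
  numQueries : ℕ
  U : Fin (numQueries + 1) → Matrix.unitaryGroup query.Label ℂ

/-- The operator `A_f = U_n Q_f U_{n-1} Q_f ⋯ U_1 Q_f U_0`. -/
def Circuit.op {D K : Type} (A : Circuit D K) (f : D → K) :
    Matrix A.query.Label A.query.Label ℂ :=
  Fin.induction (motive := fun _ => Matrix A.query.Label A.query.Label ℂ)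
    (A.U 0 : Matrix A.query.Label A.query.Label ℂ)
    (fun j M => (A.U j.succ : Matrix A.query.Label A.query.Label ℂ) * A.query.op f * M)
    (Fin.last A.numQueries)

/-- A quantum algorithm (for functions `D → K`, with output in `G`) with `k ≥ 1` measurements:
algorithms without measurement `A_0, …, A_{k-1}`, the initial basis states
`b_ℓ = b_ℓ(x_0, …, x_{ℓ-1})` of the `ℓ`-th stage, determined by the results of the earlier
measurements (so `b_0` is a constant), and the final classical output map `φ`. -/
structure Algorithm (D K G : Type) where
  k : ℕ
  k_pos : 0 < k
  circuit : Fin k → Circuit D K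
  b : ∀ l : Fin k, (∀ i : {i : Fin k // i < l}, (circuit i.1).query.Label) →
    (circuit l).query.Label
  φ : (∀ l : Fin k, (circuit l).query.Label) → G

/-- The total number of queries. -/
def Algorithm.numQueries {D K G : Type} (A : Algorithm D K G) : ℕ :=
  ∑ l, (A.circuit l).numQueries

/-- The probability that on input `f` the `k` measurements give the results
`x_0, …, x_{k-1}`, namely `∏_ℓ |⟨x_ℓ| A_{ℓ,f} |b_ℓ(x_0, …, x_{ℓ-1})⟩|²`. -/
def Algorithm.outcomeProb {D K G : Type} (A : Algorithm D K G) (f : D → K)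
    (x : ∀ l : Fin A.k, (A.circuit l).query.Label) : ℝ :=
  ∏ l, ‖(A.circuit l).op f (x l) (A.b l fun i => x i.1)‖ ^ 2

open Classical in
/-- The probability that the output of `A` on input `f` belongs to `C`. -/
def Algorithm.prob {D K G : Type} (A : Algorithm D K G) (f : D → K) (C : Set G) : ℝ :=
  ∑ x, if A.φ x ∈ C then A.outcomeProb f x else 0

/-- The error of `A` on `F` for the solution operator `S : F → G`: the supremum over `f ∈ F` of
the infimum of all `ε ≥ 0` such that `P{‖S f - A(f)‖ > ε} ≤ 1/4`. -/
def algError {D K G : Type} [NormedAddCommGroup G] (F : Set (D → K)) (S : F → G)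
    (A : Algorithm D K G) : ℝ≥0∞ :=
  ⨆ f : F, ⨅ (ε : ℝ≥0) (_ : A.prob f.1 {g | (ε : ℝ) < ‖S f - g‖} ≤ 1 / 4), (ε : ℝ≥0∞)

/-- The `n`-th minimal quantum error `e_n^q(S, F)`: the infimum of the errors of all quantum
algorithms with at most `n` queries. -/
def minError {D K G : Type} [NormedAddCommGroup G] (n : ℕ) (F : Set (D → K)) (S : F → G) :
    ℝ≥0∞ :=
  ⨅ (A : Algorithm D K G) (_ : A.numQueries ≤ n), algError F S A

/-! ### Sobolev spaces on the unit cube -/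

/-- The cube `[0,1]^d`. -/
abbrev Cube (d : ℕ) : Type := ↥(Icc (0 : Fin d → ℝ) 1)

/-- Lebesgue measure on `[0,1]^d`. -/
def cubeMeasure (d : ℕ) : Measure (Cube d) :=
  Measure.comap Subtype.val (volume : Measure (Fin d → ℝ))

instance (d : ℕ) : IsFiniteMeasure (cubeMeasure d) := by
  refine ⟨?_⟩
  rw [cubeMeasure, comap_subtype_coe_apply measurableSet_Icc, image_univ, Subtype.range_coe]
  exact isCompact_Icc.measure_lt_top

/-- The interior of `[0,1]^d`. -/
def openCube (d : ℕ) : TopologicalSpace.Opens (Fin d → ℝ) :=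
  ⟨interior (Icc 0 1), isOpen_interior⟩

/-- The classical partial derivative of a function on `ℝ^d`. -/
def partialDeriv {d : ℕ} (i : Fin d) (ψ : (Fin d → ℝ) → ℝ) : (Fin d → ℝ) → ℝ :=
  fun x => fderiv ℝ ψ x (Pi.single i 1)

/-- The classical mixed derivative `∂^α`, for a multi-index `α`. -/
def mixedDeriv {d : ℕ} (α : Fin d → ℕ) (ψ : (Fin d → ℝ) → ℝ) : (Fin d → ℝ) → ℝ :=
  (List.finRange d).foldr (fun i χ => (partialDeriv i)^[α i] χ) ψ

/-- `g` is a weak (generalized) derivative `∂^α f` in the interior of the cube. It is used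
only for integrable `f` and `g`. -/
def IsWeakDeriv {d : ℕ} (α : Fin d → ℕ) (f g : Cube d → ℝ) : Prop :=
  ∀ ψ : TestFunction (openCube d) ℝ ⊤,
    ∫ x, f x * mixedDeriv α ψ x ∂cubeMeasure d =
      (-1) ^ (∑ i, α i) * ∫ x, g x * ψ x ∂cubeMeasure d

/-- The multi-indices `α` in dimension `d` with `|α| ≤ r`. -/
def multiIndices (d r : ℕ) : Finset (Fin d → ℕ) :=
  (Fintype.piFinset fun _ => Finset.range (r + 1)).filter fun α => ∑ i, α i ≤ r

/-- `g` collects weak derivatives of `f` of all orders `|α| ≤ r`, and all of them are in `L_p`. -/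
def HasSobolevDerivs {d : ℕ} (r : ℕ) (p : ℝ≥0∞) (f : Cube d → ℝ)
    (g : (Fin d → ℕ) → Cube d → ℝ) : Prop :=
  ∀ α ∈ multiIndices d r, IsWeakDeriv α f (g α) ∧ MemLp (g α) p (cubeMeasure d)

/-- `(∑_{|α| ≤ r} ‖g_α‖_p ^ p) ^ (1 / p)` for `p < ∞`, and `max_{|α| ≤ r} ‖g_α‖_∞` for
`p = ∞`. -/
def derivNorm {d : ℕ} (r : ℕ) (p : ℝ≥0∞) (g : (Fin d → ℕ) → Cube d → ℝ) : ℝ≥0∞ :=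
  if p = ∞ then ⨆ α ∈ multiIndices d r, eLpNorm (g α) ∞ (cubeMeasure d)
  else (∑ α ∈ multiIndices d r, eLpNorm (g α) p (cubeMeasure d) ^ p.toReal) ^ (1 / p.toReal)

/-- The Sobolev norm of `f` in `W_p^r([0,1]^d)`; it is `∞` if `f` is not in this space. Weak
derivatives are unique up to null sets, so that all `g` below give the same value. -/
def sobolevNorm {d : ℕ} (r : ℕ) (p : ℝ≥0∞) (f : Cube d → ℝ) : ℝ≥0∞ :=
  ⨅ (g : (Fin d → ℕ) → Cube d → ℝ) (_ : HasSobolevDerivs r p f g), derivNorm r p g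

/-- The unit ball of `W_p^r([0,1]^d)`, as a set of functions on `[0,1]^d`. For `r / d > 1 / p`,
each class in `W_p^r([0,1]^d)` has exactly one continuous representative, and the elements of the
space are identified with these, so that function values make sense. -/
def sobolevBall (d r : ℕ) (p : ℝ≥0∞) : Set (Cube d → ℝ) :=
  {f | Continuous f ∧ sobolevNorm r p f ≤ 1}

/-- The embedding `J_{pq} f = f` into `L_q([0,1]^d)`, on the unit ball of `W_p^r([0,1]^d)`. -/
def sobolevEmbedding (d r : ℕ) (p q : ℝ≥0∞) [Fact (1 ≤ q)] (f : sobolevBall d r p) :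
    Lp ℝ q (cubeMeasure d) :=
  ContinuousMap.toLp q (cubeMeasure d) ℝ (⟨f.1, f.2.1⟩ : C(Cube d, ℝ))

end QuantumIBC

end

noncomputable section

namespace QuantumIBC

/-! ### Low degree functions on the Boolean cube -/

/-! The proof combines the polynomial method with a counting argument. Divide the cube into `N = M ^
d` cells with `N ≥ 16 n`, and put on each cell a scaled smooth bump of height about `M ^ (-r)` with
a free sign. Every sign pattern gives a function in the unit ball, and each function value depends
on at most one sign (`fooling_mem_sobolevBall`, `bitLocal_fooling`).

For such inputs the entries of the query operator have degree at most one in the signs, so the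
amplitude of a complete sequence of measurement results has degree at most the total number of
queries (`Circuit.op_mem_lowDegree`, `prod_mem_lowDegree`). By Parseval and Cauchy–Schwarz, a
function of degree at most `k` has squared modulus at most `D` times its mean square, where `D`
counts the sets of at most `k` signs. If each output is acceptable for at most `b` patterns, success
probability `3/4` on all patterns forces `2 ^ N * (3/4) ≤ b * D` (`guessing_bound`).

Two patterns at Hamming distance `h` give functions whose `L_1` distance is proportional to `M ^
(-r) * h / N`, and the `L_q` distance is at least as large. An output close to both therefore forces
`h ≤ N / 16`. Hence `b ≤ D`, which contradicts `D ^ 2 < 2 ^ N * (3/4)` (`card_smallSets_sq_lt`). The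
error is thus at least of order `M ^ (-r)`, and `M` of order `n ^ (1/d)` gives the rate. -/

/-- The sign `±1` encoded by a bit. -/
def boolSign (b : Bool) : ℝ := if b then 1 else -1

/-- The Walsh function of a set of coordinates. -/
def walsh {ι : Type} (S : Finset ι) (ε : ι → Bool) : ℂ := ∏ i ∈ S, (boolSign (ε i) : ℂ)

lemma conj_walsh {ι : Type} (S : Finset ι) (ε : ι → Bool) : (starRingEnd ℂ) (walsh S ε) = walsh S ε := by
  simp [walsh, map_prod]

lemma norm_walsh {ι : Type} (S : Finset ι) (ε : ι → Bool) : ‖walsh S ε‖ = 1 := by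
  rw [walsh, norm_prod]
  refine Finset.prod_eq_one fun i _ => ?_
  cases ε i <;> simp [boolSign]

section BooleanCube

variable {ι : Type} [Fintype ι] [DecidableEq ι]

/-- The space of functions of degree at most `k` on the Boolean cube. -/
def lowDegree (ι : Type) [Fintype ι] [DecidableEq ι] (k : ℕ) : Submodule ℂ ((ι → Bool) → ℂ) :=
  Submodule.span ℂ (walsh '' {S : Finset ι | S.card ≤ k})

/-- The sets of at most `k` coordinates. -/
def smallSets (ι : Type) [Fintype ι] [DecidableEq ι] (k : ℕ) : Finset (Finset ι) :=
  Finset.univ.filter fun S => S.card ≤ k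

lemma walsh_mul (S T : Finset ι) : walsh S * walsh T = walsh (symmDiff S T) := by
  ext ε
  simp only [walsh, Pi.mul_apply]
  rw [← Fintype.prod_ite_mem S, ← Fintype.prod_ite_mem T, ← Fintype.prod_ite_mem (symmDiff S T),
    ← Finset.prod_mul_distrib]
  refine Finset.prod_congr rfl fun i _ => ?_
  by_cases h1 : i ∈ S <;> by_cases h2 : i ∈ T <;> cases ε i <;>
    simp [Finset.mem_symmDiff, h1, h2, boolSign]

lemma sum_walsh (U : Finset ι) :
    ∑ ε, walsh U ε = if U = ∅ then (2 : ℂ) ^ Fintype.card ι else 0 := by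
  have h1 : ∑ ε : ι → Bool, walsh U ε
      = ∏ i, ∑ b : Bool, if i ∈ U then (boolSign b : ℂ) else 1 := by
    rw [Finset.prod_univ_sum, Fintype.piFinset_univ]
    refine Finset.sum_congr rfl fun ε _ => ?_
    rw [Fintype.prod_ite_mem]
    rfl
  rw [h1]
  split_ifs with h
  · subst h
    simp
  · obtain ⟨i, hi⟩ := Finset.nonempty_iff_ne_empty.2 h
    refine Finset.prod_eq_zero (Finset.mem_univ i) ?_
    simp [hi, boolSign]

lemma sum_walsh_mul (S T : Finset ι) :
    ∑ ε, walsh S ε * walsh T ε = if S = T then (2 : ℂ) ^ Fintype.card ι else 0 := by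
  have h := sum_walsh (symmDiff S T)
  rw [← walsh_mul] at h
  simp only [Pi.mul_apply, ← Finset.bot_eq_empty, symmDiff_eq_bot] at h
  exact h

/-- Parseval's identity, from the orthogonality of the Walsh functions. -/
lemma sum_norm_sq_walsh (s : Finset (Finset ι)) (c : Finset ι → ℂ) :
    ∑ ε, ‖∑ S ∈ s, c S * walsh S ε‖ ^ 2 = 2 ^ Fintype.card ι * ∑ S ∈ s, ‖c S‖ ^ 2 := by
  have key : (∑ ε, (‖∑ S ∈ s, c S * walsh S ε‖ ^ 2 : ℂ))
      = 2 ^ Fintype.card ι * ∑ S ∈ s, (‖c S‖ ^ 2 : ℂ) := by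
    simp_rw [← Complex.mul_conj', map_sum, map_mul, conj_walsh, Finset.sum_mul_sum]
    rw [Finset.sum_comm, Finset.mul_sum]
    refine Finset.sum_congr rfl fun S hS => ?_
    rw [Finset.sum_comm]
    have h1 : ∀ T, ∑ ε, c S * walsh S ε * ((starRingEnd ℂ) (c T) * walsh T ε)
        = c S * (starRingEnd ℂ) (c T) * if S = T then (2 : ℂ) ^ Fintype.card ι else 0 := by
      intro T
      rw [← sum_walsh_mul, Finset.mul_sum]
      exact Finset.sum_congr rfl fun ε _ => by ring
    simp_rw [h1]
    simp [hS]
    ring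
  exact_mod_cast key

lemma exists_coeff_of_mem_lowDegree {k : ℕ} {a : (ι → Bool) → ℂ} (ha : a ∈ lowDegree ι k) :
    ∃ c : Finset ι → ℂ, ∀ ε, a ε = ∑ S ∈ smallSets ι k, c S * walsh S ε := by
  unfold lowDegree at ha
  induction ha using Submodule.span_induction with
  | mem x hx =>
    obtain ⟨S, hS, rfl⟩ := hx
    refine ⟨fun T => if T = S then 1 else 0, fun ε => ?_⟩
    have : S ∈ smallSets ι k := by simpa [smallSets] using hS
    simp [this]
  | zero => exact ⟨0, by simp⟩
  | add x y _ _ hx hy =>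
    obtain ⟨c, hc⟩ := hx
    obtain ⟨c', hc'⟩ := hy
    exact ⟨c + c', fun ε => by simp [hc, hc', add_mul, Finset.sum_add_distrib]⟩
  | smul t x _ hx =>
    obtain ⟨c, hc⟩ := hx
    exact ⟨t • c, fun ε => by simp [hc, Finset.mul_sum, mul_assoc]⟩

/-- A function of low degree is nowhere much larger than in quadratic mean. -/
lemma norm_sq_le_of_mem_lowDegree {k : ℕ} {a : (ι → Bool) → ℂ} (ha : a ∈ lowDegree ι k)
    (ε : ι → Bool) :
    2 ^ Fintype.card ι * ‖a ε‖ ^ 2 ≤ (smallSets ι k).card * ∑ ε', ‖a ε'‖ ^ 2 := by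
  obtain ⟨c, hc⟩ := exists_coeff_of_mem_lowDegree ha
  simp_rw [hc, sum_norm_sq_walsh]
  -- Walsh functions have modulus one, so the value is at most the `ℓ_1` norm of the coefficients;
  -- Cauchy–Schwarz then passes to their `ℓ_2` norm.
  have h1 : ‖∑ S ∈ smallSets ι k, c S * walsh S ε‖ ≤ ∑ S ∈ smallSets ι k, ‖c S‖ :=
    (norm_sum_le _ _).trans (le_of_eq (by simp [norm_walsh]))
  have h2 : ‖∑ S ∈ smallSets ι k, c S * walsh S ε‖ ^ 2
      ≤ (smallSets ι k).card * ∑ S ∈ smallSets ι k, ‖c S‖ ^ 2 :=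
    (pow_le_pow_left₀ (norm_nonneg _) h1 2).trans sq_sum_le_card_mul_sum_sq
  calc _ ≤ (2 : ℝ) ^ Fintype.card ι * ((smallSets ι k).card * ∑ S ∈ smallSets ι k, ‖c S‖ ^ 2) := by
        gcongr
    _ = _ := by ring

lemma lowDegree_mono {k l : ℕ} (h : k ≤ l) : lowDegree ι k ≤ lowDegree ι l :=
  Submodule.span_mono (image_mono fun _ hS => le_trans hS h)

lemma mul_mem_lowDegree {k l : ℕ} {a b : (ι → Bool) → ℂ} (ha : a ∈ lowDegree ι k)
    (hb : b ∈ lowDegree ι l) : a * b ∈ lowDegree ι (k + l) := by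
  have h := Submodule.mul_mem_mul ha hb
  unfold lowDegree at h ⊢
  rw [Submodule.span_mul_span] at h
  refine Submodule.span_mono ?_ h
  rintro _ ⟨_, ⟨S, hS, rfl⟩, _, ⟨T, hT, rfl⟩, rfl⟩
  refine ⟨symmDiff S T, ?_, (walsh_mul S T).symm⟩
  have h1 : (symmDiff S T).card ≤ (S ∪ T).card := Finset.card_le_card symmDiff_le_sup
  have h2 := Finset.card_union_le S T
  simp only [mem_ofPred_eq] at hS hT ⊢
  omega

lemma const_mem_lowDegree (k : ℕ) (z : ℂ) : (fun _ : ι → Bool => z) ∈ lowDegree ι k := by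
  have h : z • walsh (∅ : Finset ι) ∈ lowDegree ι k :=
    Submodule.smul_mem _ _ (Submodule.subset_span ⟨∅, by simp, rfl⟩)
  convert h using 1
  ext ε
  simp [walsh]

lemma prod_mem_lowDegree {κ : Type*} (s : Finset κ) (k : κ → ℕ) (a : κ → (ι → Bool) → ℂ)
    (ha : ∀ l ∈ s, a l ∈ lowDegree ι (k l)) : ∏ l ∈ s, a l ∈ lowDegree ι (∑ l ∈ s, k l) := by
  classical
  induction s using Finset.induction_on with
  | empty => exact const_mem_lowDegree (ι := ι) 0 1
  | insert l s hl ih =>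
    rw [Finset.prod_insert hl, Finset.sum_insert hl]
    exact mul_mem_lowDegree (ha l (by simp)) (ih fun i hi => ha i (by simp [hi]))

/-- A function of one bit takes two values, and an affine function of the sign interpolates them. -/
lemma mem_lowDegree_one_of_bit {a : (ι → Bool) → ℂ} (j : ι)
    (h : ∀ ε ε' : ι → Bool, ε j = ε' j → a ε = a ε') : a ∈ lowDegree ι 1 := by
  set u := a fun _ => true
  set v := a fun _ => false
  have h1 : ((u - v) / 2) • walsh ({j} : Finset ι) ∈ lowDegree ι 1 :=
    Submodule.smul_mem _ _ (Submodule.subset_span ⟨{j}, by simp, rfl⟩)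
  convert Submodule.add_mem _ h1 (const_mem_lowDegree 1 ((u + v) / 2)) using 1
  ext ε
  cases hε : ε j
  · rw [h ε (fun _ => false) hε]
    simp [walsh, hε, boolSign]
    ring
  · rw [h ε (fun _ => true) hε]
    simp [walsh, hε, boolSign]
    ring

/-- If the outcome probabilities are squares of functions of low degree and each outcome is
compatible with few inputs, then the outcome cannot be compatible with the input too often. -/
lemma guessing_bound {X : Type*} [Fintype X] {k : ℕ} (a : X → (ι → Bool) → ℂ)
    (ha : ∀ x, a x ∈ lowDegree ι k) (h1 : ∀ ε, ∑ x, ‖a x ε‖ ^ 2 = 1)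
    (B : X → Finset (ι → Bool)) (b : ℕ) (hB : ∀ x, (B x).card ≤ b)
    (t : ℝ) (h : ∀ ε, t ≤ ∑ x, if ε ∈ B x then ‖a x ε‖ ^ 2 else 0) :
    2 ^ Fintype.card ι * t ≤ b * (smallSets ι k).card := by
  set N : ℝ := 2 ^ Fintype.card ι with hN
  set D : ℝ := ((smallSets ι k).card : ℝ)
  have hN0 : 0 < N := by positivity
  have hcard : ((Finset.univ : Finset (ι → Bool)).card : ℝ) = N := by simp [hN]
  have e1 : N * t ≤ ∑ ε, ∑ x, if ε ∈ B x then ‖a x ε‖ ^ 2 else 0 := by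
    have := Finset.sum_le_sum fun ε (_ : ε ∈ (Finset.univ : Finset (ι → Bool))) => h ε
    rwa [Finset.sum_const, nsmul_eq_mul, hcard] at this
  have e2 : ∀ x, N * ∑ ε, (if ε ∈ B x then ‖a x ε‖ ^ 2 else 0)
      ≤ b * (D * ∑ ε, ‖a x ε‖ ^ 2) := by
    intro x
    rw [Finset.sum_ite_mem, Finset.univ_inter, Finset.mul_sum]
    calc _ ≤ ∑ ε ∈ B x, D * ∑ ε, ‖a x ε‖ ^ 2 :=
          Finset.sum_le_sum fun ε _ => norm_sq_le_of_mem_lowDegree (ha x) ε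
      _ = (B x).card * (D * ∑ ε, ‖a x ε‖ ^ 2) := by rw [Finset.sum_const, nsmul_eq_mul]
      _ ≤ _ := by
        have : ((B x).card : ℝ) ≤ b := by exact_mod_cast hB x
        gcongr
  -- After the order of summation is exchanged, the mean squares of all outcomes add up to one, so
  -- the number of outcomes does not enter.
  have e3 : N * (N * t) ≤ N * (b * D) := by
    calc N * (N * t) ≤ N * ∑ ε, ∑ x, if ε ∈ B x then ‖a x ε‖ ^ 2 else 0 := by gcongr
      _ = ∑ x, N * ∑ ε, (if ε ∈ B x then ‖a x ε‖ ^ 2 else 0) := by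
        rw [Finset.sum_comm, Finset.mul_sum]
      _ ≤ ∑ x, b * (D * ∑ ε, ‖a x ε‖ ^ 2) := Finset.sum_le_sum fun x _ => e2 x
      _ = b * D * ∑ ε, ∑ x, ‖a x ε‖ ^ 2 := by
        rw [Finset.sum_comm (s := Finset.univ (α := ι → Bool)), Finset.mul_sum]
        exact Finset.sum_congr rfl fun x _ => by ring
      _ = N * (b * D) := by
        simp_rw [h1]
        rw [Finset.sum_const, nsmul_eq_mul, hcard]
        ring
  exact le_of_mul_le_mul_left e3 hN0

/-- A Chernoff-type bound: give `S` the weight `(1/8) ^ |S|`, which is at least `(1/8) ^ k` on small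
sets, and sum over all sets with the binomial theorem. -/
lemma card_smallSets_le (k : ℕ) :
    ((smallSets ι k).card : ℝ) ≤ 8 ^ k * (9 / 8) ^ Fintype.card ι := by
  have h := Finset.sum_pow_mul_eq_add_pow (1 / 8 : ℝ) 1 (Finset.univ : Finset ι)
  rw [Finset.powerset_univ] at h
  have h2 : (smallSets ι k).card * (1 / 8 : ℝ) ^ k ≤ (9 / 8) ^ Fintype.card ι := by
    calc _ = ∑ S ∈ smallSets ι k, (1 / 8 : ℝ) ^ k := by rw [Finset.sum_const, nsmul_eq_mul]
      _ ≤ ∑ S ∈ smallSets ι k, (1 / 8 : ℝ) ^ S.card := by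
        refine Finset.sum_le_sum fun S hS => ?_
        exact pow_le_pow_of_le_one (by norm_num) (by norm_num) (Finset.mem_filter.1 hS).2
      _ ≤ ∑ S : Finset ι, (1 / 8 : ℝ) ^ S.card :=
        Finset.sum_le_sum_of_subset_of_nonneg (Finset.subset_univ _) fun _ _ _ => by positivity
      _ = (1 / 8 + 1) ^ Fintype.card ι := by simpa using h
      _ = _ := by norm_num
  have h8 : (8 : ℝ) ^ k * (1 / 8) ^ k = 1 := by rw [← mul_pow]; norm_num
  calc ((smallSets ι k).card : ℝ) = 8 ^ k * ((smallSets ι k).card * (1 / 8 : ℝ) ^ k) := by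
        rw [mul_left_comm, h8, mul_one]
    _ ≤ _ := by gcongr

/-- Since `64 ≤ (4/3) ^ 16`, the factor `64 ^ k` costs at most `(4/3) ^ N`, and `(4/3) * (9/8) ^ 2 =
2 * (27/32)`. Two coordinates are needed for `(27/32) ^ N` to drop below `3/4`. -/
lemma card_smallSets_sq_lt {k : ℕ} (hk : 16 * k ≤ Fintype.card ι) (h2 : 2 ≤ Fintype.card ι) :
    ((smallSets ι k).card : ℝ) * (smallSets ι k).card < 2 ^ Fintype.card ι * (3 / 4) := by
  set N := Fintype.card ι
  have h := card_smallSets_le (ι := ι) k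
  have e1 : ((8 : ℝ) ^ k) * 8 ^ k ≤ (4 / 3) ^ N := by
    calc ((8 : ℝ) ^ k) * 8 ^ k = 64 ^ k := by rw [← mul_pow]; norm_num
      _ ≤ ((4 / 3) ^ 16) ^ k := by gcongr; norm_num
      _ = (4 / 3) ^ (16 * k) := by rw [← pow_mul]
      _ ≤ _ := pow_le_pow_right₀ (by norm_num) hk
  have e2 : (27 / 32 : ℝ) ^ N ≤ (27 / 32) ^ 2 :=
    pow_le_pow_of_le_one (by norm_num) (by norm_num) h2
  calc _ ≤ (8 ^ k * (9 / 8 : ℝ) ^ N) * (8 ^ k * (9 / 8) ^ N) := by gcongr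
    _ = (8 ^ k * 8 ^ k) * ((9 / 8 : ℝ) ^ N * (9 / 8) ^ N) := by ring
    _ ≤ (4 / 3) ^ N * ((9 / 8 : ℝ) ^ N * (9 / 8) ^ N) := by gcongr
    _ = 2 ^ N * (27 / 32) ^ N := by rw [← mul_pow, ← mul_pow, ← mul_pow]; norm_num
    _ < _ := by
      gcongr
      exact e2.trans_lt (by norm_num)

/-- Fix one member of `B` and encode every other one by the set of coordinates where they differ;
for bits this set determines the string. -/
lemma card_le_of_hammingDist_le (B : Finset (ι → Bool)) (k : ℕ)
    (h : ∀ ε ∈ B, ∀ ε' ∈ B, hammingDist ε ε' ≤ k) : B.card ≤ (smallSets ι k).card := by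
  obtain rfl | ⟨ε₀, h₀⟩ := B.eq_empty_or_nonempty
  · simp
  refine Finset.card_le_card_of_injOn (fun ε => Finset.univ.filter fun i => ε i ≠ ε₀ i) ?_ ?_
  · intro ε hε
    simpa [smallSets, hammingDist] using h ε hε ε₀ h₀
  · intro ε _ ε' _ hεε
    ext i
    have := Finset.ext_iff.1 hεε i
    simp only [Finset.mem_filter, Finset.mem_univ, true_and] at this
    revert this
    cases ε i <;> cases ε' i <;> cases ε₀ i <;> simp

end BooleanCube

/-! ### The amplitudes of a quantum algorithm -/

section Amplitudes

variable {D K G : Type}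

lemma Query.act_bijective (Q : Query D K) (f : D → K) : Function.Bijective (Q.act f) := by
  have : Function.Injective (Q.act f) := by
    rintro ⟨i, x, y⟩ ⟨i', x', y'⟩ h
    unfold Query.act at h
    by_cases h1 : i ∈ Q.Z <;> by_cases h2 : i' ∈ Q.Z <;>
      simp only [h1, h2, dif_pos, dif_neg, not_false_eq_true, Prod.mk.injEq] at h ⊢
    · obtain ⟨rfl, h3, rfl⟩ := h
      simpa using h3
    · exact absurd (h.1 ▸ h1) h2
    · exact absurd (h.1 ▸ h2) h1
    · exact h
  exact Finite.injective_iff_bijective.1 this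

/-- The query permutes the canonical basis, so this is a permutation matrix. -/
lemma Query.op_mem_unitaryGroup (Q : Query D K) (f : D → K) :
    Q.op f ∈ Matrix.unitaryGroup Q.Label ℂ := by
  rw [Matrix.mem_unitaryGroup_iff']
  ext a b
  simp only [Matrix.mul_apply, Matrix.star_apply, Query.op, Matrix.of_apply]
  by_cases h : a = b
  · subst h
    simp
  · have h2 : Q.act f a ≠ Q.act f b := fun e => h ((Q.act_bijective f).1 e)
    simp [h, h2.symm]

lemma Circuit.op_mem_unitaryGroup (A : Circuit D K) (f : D → K) :
    A.op f ∈ Matrix.unitaryGroup A.query.Label ℂ := by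
  unfold Circuit.op
  induction Fin.last A.numQueries using Fin.induction with
  | zero => exact (A.U 0).2
  | succ j ih =>
    rw [Fin.induction_succ]
    exact mul_mem (mul_mem (A.U j.succ).2 (A.query.op_mem_unitaryGroup f)) ih

lemma Circuit.sum_norm_sq_op (A : Circuit D K) (f : D → K) (s : A.query.Label) :
    ∑ t, ‖A.op f t s‖ ^ 2 = 1 := by
  have h := congrFun (congrFun (Matrix.mem_unitaryGroup_iff'.1 (A.op_mem_unitaryGroup f)) s) s
  simp only [Matrix.mul_apply, Matrix.star_apply, Matrix.one_apply_eq, RCLike.star_def,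
    Complex.conj_mul'] at h
  exact_mod_cast h

/-- The probabilities of the paths of a finite process with history dependent transition
probabilities add up to one. -/
lemma sum_prod_transition (k : ℕ) (X : Fin k → Type) [∀ l, Fintype (X l)]
    (w : ∀ l : Fin k, (∀ i : {i : Fin k // i < l}, X i.1) → X l → ℝ)
    (hw : ∀ l h, ∑ x, w l h x = 1) :
    ∑ x : ∀ l, X l, ∏ l, w l (fun i => x i.1) (x l) = 1 := by
  induction k with
  | zero => simp
  | succ k ih =>
    rw [← (Fin.snocEquiv X).sum_comp, Fintype.sum_prod_type]
    rw [Finset.sum_comm]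
    have hlt : ∀ {l : Fin k} {i : Fin (k + 1)}, i < l.castSucc → i.1 < k := fun {l _} h =>
      (Fin.lt_def.1 h).trans l.2
    rw [← ih (fun l => X l.castSucc) (fun l h x => w l.castSucc
      (fun (i : {i : Fin (k + 1) // i < l.castSucc}) => h ⟨⟨i.1.1, hlt i.2⟩, i.2⟩) x) (fun l h => hw l.castSucc _)]
    -- With the earlier results `y` fixed, only the last factor depends on the last result `z`, and
    -- it sums to one.
    refine Finset.sum_congr rfl fun y _ => ?_
    have e1 : ∀ z (l : Fin k),
        (fun i : {i : Fin (k + 1) // i < l.castSucc} => Fin.snocEquiv X (z, y) i.1)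
          = fun i : {i : Fin (k + 1) // i < l.castSucc} => y ⟨i.1.1, hlt i.2⟩ := by
      intro z l
      ext i
      simp [Fin.snocEquiv, Fin.snoc, hlt i.2, Fin.castLT]
    have e2 : ∀ z, (fun i : {i : Fin (k + 1) // i < Fin.last k} => Fin.snocEquiv X (z, y) i.1)
        = fun i : {i : Fin (k + 1) // i < Fin.last k} => y ⟨i.1.1, Fin.lt_def.1 i.2⟩ := by
      intro z
      ext i
      have : i.1.1 < k := Fin.lt_def.1 i.2
      simp [Fin.snocEquiv, Fin.snoc, this, Fin.castLT]
    simp_rw [Fin.prod_univ_castSucc, e1, e2]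
    simp [Fin.snocEquiv, ← Finset.mul_sum, hw]

lemma Algorithm.sum_outcomeProb (A : Algorithm D K G) (f : D → K) :
    ∑ x, A.outcomeProb f x = 1 :=
  sum_prod_transition A.k (fun l => (A.circuit l).query.Label)
    (fun l h x => ‖(A.circuit l).op f x (A.b l h)‖ ^ 2)
    (fun l _ => (A.circuit l).sum_norm_sq_op f _)

variable {ι : Type} [Fintype ι] [DecidableEq ι]

/-- A family of inputs parametrized by bits is locally determined if each value depends on one
bit only. -/
def BitLocal (F : (ι → Bool) → D → K) : Prop :=
  ∀ x, ∃ j, ∀ ε ε' : ι → Bool, ε j = ε' j → F ε x = F ε' x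

/-- A column of the matrix involves the input at no more than one point, hence depends on a single
bit. -/
lemma Query.op_mem_lowDegree (Q : Query D K) {F : (ι → Bool) → D → K} (hF : BitLocal F)
    (s t : Q.Label) : (fun ε => Q.op (F ε) s t) ∈ lowDegree ι 1 := by
  by_cases h : t.1 ∈ Q.Z
  · obtain ⟨j, hj⟩ := hF (Q.τ ⟨t.1, h⟩)
    refine mem_lowDegree_one_of_bit j fun ε ε' hε => ?_
    simp only [Query.op, Query.act, Matrix.of_apply, h, dif_pos, hj ε ε' hε]
  · convert const_mem_lowDegree (ι := ι) 1 (if s = t then 1 else 0) using 1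
    ext ε
    simp [Query.op, Query.act, h]

/-- The unitaries do not depend on the input, so only the query factors raise the degree, each by at
most one. -/
lemma Circuit.op_mem_lowDegree (A : Circuit D K) {F : (ι → Bool) → D → K} (hF : BitLocal F)
    (s t : A.query.Label) : (fun ε => A.op (F ε) s t) ∈ lowDegree ι A.numQueries := by
  unfold Circuit.op
  have main : ∀ (m : Fin (A.numQueries + 1)) (s t : A.query.Label), (fun ε =>
      Fin.induction (motive := fun _ => Matrix A.query.Label A.query.Label ℂ)
        (A.U 0 : Matrix A.query.Label A.query.Label ℂ)
        (fun j M => (A.U j.succ : Matrix A.query.Label A.query.Label ℂ) * A.query.op (F ε) * M)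
        m s t) ∈ lowDegree ι m := by
    intro m
    induction m using Fin.induction with
    | zero => exact fun s t => const_mem_lowDegree _ _
    | succ j ih =>
      intro s t
      simp only [Fin.induction_succ]
      rw [show (fun ε => _) = ∑ u, ∑ v, (fun _ => (A.U j.succ : Matrix _ _ ℂ) s v) *
        ((fun ε => A.query.op (F ε) v u) * (fun ε =>
          Fin.induction (motive := fun _ => Matrix A.query.Label A.query.Label ℂ)
          (A.U 0 : Matrix A.query.Label A.query.Label ℂ)
          (fun j M => (A.U j.succ : Matrix A.query.Label A.query.Label ℂ) * A.query.op (F ε) * M)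
            j.castSucc u t)) from by
        ext ε
        simp [Matrix.mul_apply, Finset.sum_mul, mul_assoc]]
      refine Submodule.sum_mem _ fun u _ => Submodule.sum_mem _ fun v _ => ?_
      refine lowDegree_mono ?_ (mul_mem_lowDegree (const_mem_lowDegree 0 _)
        (mul_mem_lowDegree (A.query.op_mem_lowDegree hF v u) (ih u t)))
      simp [add_comm]
  simpa using main (Fin.last _) s t

/-- The quantum lower bound for approximate recovery of a bit string. -/
theorem Algorithm.recovery_bound (A : Algorithm D K G) {F : (ι → Bool) → D → K}
    (hF : BitLocal F) {k : ℕ} (hk : A.numQueries ≤ k) (hk' : 16 * k ≤ Fintype.card ι)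
    (h2 : 2 ≤ Fintype.card ι) (C : (ι → Bool) → Set G)
    (hC : ∀ g ε ε', g ∉ C ε → g ∉ C ε' → hammingDist ε ε' ≤ k) :
    ∃ ε, 1 / 4 < A.prob (F ε) (C ε) := by
  classical
  by_contra! hcon
  -- The amplitude of a whole path of results. Once `x` is fixed, all initial states are fixed too,
  -- so the adaptivity adds no dependence on `ε`.
  set a : (∀ l : Fin A.k, (A.circuit l).query.Label) → (ι → Bool) → ℂ := fun x =>
    ∏ l, fun ε => (A.circuit l).op (F ε) (x l) (A.b l fun i => x i.1) with ha
  have hprob : ∀ x ε, ‖a x ε‖ ^ 2 = A.outcomeProb (F ε) x := by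
    intro x ε
    simp [ha, Algorithm.outcomeProb, Finset.prod_apply, Finset.prod_pow]
  have hlow : ∀ x, a x ∈ lowDegree ι k := fun x =>
    lowDegree_mono hk (prod_mem_lowDegree _ _ _ fun l _ => (A.circuit l).op_mem_lowDegree hF _ _)
  have h := guessing_bound a hlow (fun ε => by simp_rw [hprob]; exact A.sum_outcomeProb _)
    (fun x => Finset.univ.filter fun ε => A.φ x ∉ C ε) (smallSets ι k).card
    (fun x => card_le_of_hammingDist_le _ k fun ε hε ε' hε' =>
      hC (A.φ x) ε ε' (Finset.mem_filter.1 hε).2 (Finset.mem_filter.1 hε').2) (3 / 4) ?_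
  · exact absurd h (not_le.2 (card_smallSets_sq_lt hk' h2))
  · intro ε
    have e1 := hcon ε
    have e2 := A.sum_outcomeProb (F ε)
    have e3 : A.prob (F ε) (C ε) + ∑ x, (if A.φ x ∉ C ε then A.outcomeProb (F ε) x else 0) = 1 := by
      rw [← e2, Algorithm.prob, ← Finset.sum_add_distrib]
      refine Finset.sum_congr rfl fun x _ => ?_
      by_cases hx : A.φ x ∈ C ε <;> simp [hx]
    simp only [hprob, Finset.mem_filter, Finset.mem_univ, true_and]
    linarith

end Amplitudes

/-! ### Iterated partial derivatives -/

section Derivatives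

variable {d : ℕ}

/-- The iterated partial derivative in the directions of a list. -/
def listDeriv (L : List (Fin d)) (ψ : (Fin d → ℝ) → ℝ) : (Fin d → ℝ) → ℝ :=
  L.foldr partialDeriv ψ

/-- The directions of the mixed derivative `∂^α`, in the order in which they are listed in its
definition. -/
def directions (α : Fin d → ℕ) : List (Fin d) :=
  (List.finRange d).flatMap fun i => List.replicate (α i) i

lemma listDeriv_append (L L' : List (Fin d)) (ψ : (Fin d → ℝ) → ℝ) :
    listDeriv (L ++ L') ψ = listDeriv L (listDeriv L' ψ) := by
  simp [listDeriv]

lemma listDeriv_replicate (n : ℕ) (i : Fin d) (ψ : (Fin d → ℝ) → ℝ) :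
    listDeriv (List.replicate n i) ψ = (partialDeriv i)^[n] ψ := by
  induction n with
  | zero => rfl
  | succ n ih =>
    rw [Function.iterate_succ_apply', ← ih]
    rfl

lemma mixedDeriv_eq_listDeriv (α : Fin d → ℕ) (ψ : (Fin d → ℝ) → ℝ) :
    mixedDeriv α ψ = listDeriv (directions α) ψ := by
  unfold mixedDeriv directions
  induction List.finRange d with
  | nil => rfl
  | cons i L ih => rw [List.foldr_cons, List.flatMap_cons, listDeriv_append, ih, listDeriv_replicate]

lemma length_directions (α : Fin d → ℕ) : (directions α).length = ∑ i, α i := by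
  simp [directions, List.length_flatMap, Fin.sum_univ_def]

lemma contDiff_partialDeriv {ψ : (Fin d → ℝ) → ℝ} (h : ContDiff ℝ (⊤ : ℕ∞) ψ) (i : Fin d) :
    ContDiff ℝ (⊤ : ℕ∞) (partialDeriv i ψ) :=
  (h.fderiv_right (m := (⊤ : ℕ∞)) (by simp)).clm_apply contDiff_const

lemma contDiff_listDeriv {ψ : (Fin d → ℝ) → ℝ} (h : ContDiff ℝ (⊤ : ℕ∞) ψ) (L : List (Fin d)) :
    ContDiff ℝ (⊤ : ℕ∞) (listDeriv L ψ) := by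
  induction L with
  | nil => exact h
  | cons i L ih => exact contDiff_partialDeriv ih i

lemma tsupport_partialDeriv_subset (ψ : (Fin d → ℝ) → ℝ) (i : Fin d) :
    tsupport (partialDeriv i ψ) ⊆ tsupport ψ :=
  tsupport_fderiv_apply_subset ℝ _

lemma tsupport_listDeriv_subset (ψ : (Fin d → ℝ) → ℝ) (L : List (Fin d)) :
    tsupport (listDeriv L ψ) ⊆ tsupport ψ := by
  induction L with
  | nil => exact subset_rfl
  | cons i L ih => exact (tsupport_partialDeriv_subset _ i).trans ih

lemma hasCompactSupport_listDeriv {ψ : (Fin d → ℝ) → ℝ} (h : HasCompactSupport ψ)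
    (L : List (Fin d)) : HasCompactSupport (listDeriv L ψ) :=
  h.of_isClosed_subset (isClosed_tsupport _) (tsupport_listDeriv_subset ψ L)

/-- Repeated integration by parts, without boundary terms because `φ` has compact support. The
outermost derivative of `φ` reaches `f` first, which reverses the order and avoids any appeal to the
symmetry of mixed derivatives. -/
lemma integral_mul_listDeriv {f φ : (Fin d → ℝ) → ℝ} (hf : ContDiff ℝ (⊤ : ℕ∞) f)
    (hφ : ContDiff ℝ (⊤ : ℕ∞) φ) (hc : HasCompactSupport φ) (L : List (Fin d)) :
    ∫ x, f x * listDeriv L φ x = (-1) ^ L.length * ∫ x, listDeriv L.reverse f x * φ x := by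
  induction L generalizing f with
  | nil => simp [listDeriv]
  | cons i L ih =>
    have hcL := hasCompactSupport_listDeriv hc L
    have hdL := contDiff_listDeriv hφ L
    have hi := contDiff_partialDeriv hf i
    have key : ∫ x, f x * partialDeriv i (listDeriv L φ) x
        = -∫ x, partialDeriv i f x * listDeriv L φ x := by
      apply integral_mul_fderiv_eq_neg_fderiv_mul_of_integrable
      · exact (hi.continuous.mul hdL.continuous).integrable_of_hasCompactSupport hcL.mul_left
      · exact (hf.continuous.mul (contDiff_partialDeriv hdL i).continuous).integrable_of_hasCompactSupport
          (hasCompactSupport_listDeriv hc (i :: L)).mul_left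
      · exact (hf.continuous.mul hdL.continuous).integrable_of_hasCompactSupport hcL.mul_left
      · exact fun x _ => hf.differentiable (by simp) x
      · exact fun x _ => hdL.differentiable (by simp) x
    rw [List.reverse_cons, listDeriv_append, List.length_cons, pow_succ]
    change ∫ x, f x * partialDeriv i (listDeriv L φ) x = _
    rw [key, ih hi]
    simp [listDeriv]

end Derivatives

/-! ### Smooth functions on the cube -/

section Cube

variable {d : ℕ}

instance (d : ℕ) : IsProbabilityMeasure (cubeMeasure d) := by
  refine ⟨?_⟩
  rw [cubeMeasure, comap_subtype_coe_apply measurableSet_Icc, image_univ, Subtype.range_coe,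
    Real.volume_Icc_pi]
  simp

lemma integral_cube_of_support_subset {h : (Fin d → ℝ) → ℝ}
    (hs : Function.support h ⊆ Icc 0 1) : ∫ x : Cube d, h x ∂cubeMeasure d = ∫ x, h x := by
  rw [cubeMeasure, integral_subtype_comap measurableSet_Icc h,
    setIntegral_eq_integral_of_forall_compl_eq_zero]
  intro x hx
  by_contra hne
  exact hx (hs hne)

lemma isWeakDeriv_of_contDiff {f : (Fin d → ℝ) → ℝ} (hf : ContDiff ℝ (⊤ : ℕ∞) f)
    (α : Fin d → ℕ) :
    IsWeakDeriv α (fun x => f x) (fun x => listDeriv (directions α).reverse f x) := by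
  intro φ
  have hsub : tsupport φ ⊆ Icc 0 1 :=
    (TestFunctionClass.tsupport_map_subset φ).trans interior_subset
  rw [mixedDeriv_eq_listDeriv, ← length_directions,
    integral_cube_of_support_subset (h := fun x => f x * listDeriv (directions α) φ x),
    integral_cube_of_support_subset (h := fun x => listDeriv (directions α).reverse f x * φ x)]
  · exact integral_mul_listDeriv hf (TestFunctionClass.map_contDiff φ)
      (TestFunctionClass.map_hasCompactSupport φ) _
  · exact (Function.support_mul_subset_right _ _).trans ((subset_tsupport _).trans hsub)
  · exact (Function.support_mul_subset_right _ _).trans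
      ((subset_tsupport _).trans ((tsupport_listDeriv_subset _ _).trans hsub))

lemma multiIndices_card_pos (d r : ℕ) : 0 < (multiIndices d r).card :=
  Finset.card_pos.2 ⟨0, by simp [multiIndices]⟩

/-- The measure has mass one, so sup bounds control every `L_s` norm. Powers `p ≥ 1` only decrease
numbers below one, so the sum has at most `card` terms of size `1 / card`. -/
lemma derivNorm_le_one {r : ℕ} {p : ℝ≥0∞} (hp : 1 ≤ p) {g : (Fin d → ℕ) → Cube d → ℝ}
    (hg : ∀ α ∈ multiIndices d r, ∀ x, |g α x| ≤ 1 / (multiIndices d r).card) :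
    derivNorm r p g ≤ 1 := by
  have hcard : (1 : ℝ) ≤ (multiIndices d r).card := by exact_mod_cast multiIndices_card_pos d r
  have hb : ∀ α ∈ multiIndices d r, ∀ s : ℝ≥0∞,
      eLpNorm (g α) s (cubeMeasure d) ≤ ENNReal.ofReal (1 / (multiIndices d r).card) := by
    intro α hα s
    simpa using eLpNorm_le_of_ae_bound (p := s) (μ := cubeMeasure d) (f := g α)
      (Filter.Eventually.of_forall (hg α hα))
  have h1 : ENNReal.ofReal (1 / (multiIndices d r).card) ≤ 1 := by
    rw [ENNReal.ofReal_le_one]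
    exact div_le_one_of_le₀ hcard (by positivity)
  unfold derivNorm
  split_ifs with h
  · exact iSup₂_le fun α hα => (hb α hα _).trans h1
  · have hp1 : 1 ≤ p.toReal := by
      rw [← ENNReal.toReal_one]
      exact (ENNReal.toReal_le_toReal ENNReal.one_ne_top h).2 hp
    have h2 : ∑ α ∈ multiIndices d r, eLpNorm (g α) p (cubeMeasure d) ^ p.toReal ≤ 1 := by
      calc _ ≤ ∑ α ∈ multiIndices d r, ENNReal.ofReal (1 / (multiIndices d r).card) := by
            refine Finset.sum_le_sum fun α hα => ?_
            calc _ ≤ ENNReal.ofReal (1 / (multiIndices d r).card) ^ p.toReal :=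
                  ENNReal.rpow_le_rpow (hb α hα p) (by linarith)
              _ ≤ ENNReal.ofReal (1 / (multiIndices d r).card) ^ (1 : ℝ) :=
                  ENNReal.rpow_le_rpow_of_exponent_ge h1 hp1
              _ = _ := ENNReal.rpow_one _
        _ = 1 := by
          rw [Finset.sum_const, nsmul_eq_mul, ← ENNReal.ofReal_natCast,
            ← ENNReal.ofReal_mul (by positivity), mul_one_div_cancel (by positivity),
            ENNReal.ofReal_one]
    exact (ENNReal.rpow_le_rpow h2 (by positivity)).trans (by simp)

lemma mem_sobolevBall_of_contDiff {r : ℕ} {p : ℝ≥0∞} (hp : 1 ≤ p) {f : (Fin d → ℝ) → ℝ}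
    (hf : ContDiff ℝ (⊤ : ℕ∞) f)
    (hb : ∀ α ∈ multiIndices d r, ∀ x,
      |listDeriv (directions α).reverse f x| ≤ 1 / (multiIndices d r).card) :
    (fun x : Cube d => f x) ∈ sobolevBall d r p := by
  refine ⟨hf.continuous.comp continuous_subtype_val, ?_⟩
  have hd : HasSobolevDerivs r p (fun x : Cube d => f x)
      fun α x => listDeriv (directions α).reverse f x := by
    refine fun α hα => ⟨isWeakDeriv_of_contDiff hf α, ?_⟩
    exact MemLp.of_bound ((contDiff_listDeriv hf _).continuous.comp
      continuous_subtype_val).aestronglyMeasurable _ (Filter.Eventually.of_forall fun x => hb α hα x)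
  exact (iInf₂_le _ hd).trans (derivNorm_le_one hp fun α hα x => hb α hα x)

end Cube

/-! ### Superpositions of scaled bumps -/

section Grid

variable {d M : ℕ}

/-- The open unit box. -/
def box (d : ℕ) : Set (Fin d → ℝ) := {y | ∀ i, 0 < y i ∧ y i < 1}

/-- Affine coordinates that map the `j`-th cell of the grid with mesh `1 / M` to the unit cube. -/
def cellMap (M : ℕ) (j : Fin d → Fin M) (x : Fin d → ℝ) : Fin d → ℝ :=
  (M : ℝ) • x - fun i => (j i : ℝ)

/-- A combination of the copies of `ψ` that live on the cells of the grid with mesh `1 / M`. -/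
def gridSum (M : ℕ) (a : (Fin d → Fin M) → ℝ) (ψ : (Fin d → ℝ) → ℝ) (x : Fin d → ℝ) : ℝ :=
  ∑ j, a j * ψ (cellMap M j x)

/-- Open cells are disjoint: a common point would put two distinct integers at distance less than
one. A point in no open cell admits any `j₀`. -/
lemma exists_cell [NeZero M] (x : Fin d → ℝ) :
    ∃ j₀ : Fin d → Fin M, ∀ j ≠ j₀, cellMap M j x ∉ box d := by
  by_cases h : ∃ j₀, cellMap M j₀ x ∈ box d
  · obtain ⟨j₀, h₀⟩ := h
    refine ⟨j₀, fun j hj hmem => hj ?_⟩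
    ext i
    obtain ⟨h1, h2⟩ := h₀ i
    obtain ⟨h3, h4⟩ := hmem i
    simp only [cellMap, Pi.sub_apply] at h1 h2 h3 h4
    have h5 : ((j i : ℕ) : ℝ) < (j₀ i : ℕ) + 1 := by linarith
    have h6 : ((j₀ i : ℕ) : ℝ) < (j i : ℕ) + 1 := by linarith
    norm_cast at h5 h6
    omega
  · exact ⟨0, fun j _ hj => h ⟨j, hj⟩⟩

lemma gridSum_eq_single {ψ : (Fin d → ℝ) → ℝ} (hψ : tsupport ψ ⊆ box d) {x : Fin d → ℝ}
    {j₀ : Fin d → Fin M} (h : ∀ j ≠ j₀, cellMap M j x ∉ box d) (a : (Fin d → Fin M) → ℝ) :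
    gridSum M a ψ x = a j₀ * ψ (cellMap M j₀ x) := by
  refine Finset.sum_eq_single j₀ (fun j _ hj => ?_) (by simp)
  rw [image_eq_zero_of_notMem_tsupport fun hx => h j hj (hψ hx), mul_zero]

lemma abs_gridSum_le [NeZero M] {ψ : (Fin d → ℝ) → ℝ} (hψ : tsupport ψ ⊆ box d)
    {a : (Fin d → Fin M) → ℝ} {A C : ℝ} (ha : ∀ j, |a j| ≤ A) (hC : ∀ y, |ψ y| ≤ C)
    (x : Fin d → ℝ) : |gridSum M a ψ x| ≤ A * C := by
  obtain ⟨j₀, h⟩ := exists_cell (M := M) x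
  rw [gridSum_eq_single hψ h, abs_mul]
  exact mul_le_mul (ha _) (hC _) (abs_nonneg _) ((abs_nonneg _).trans (ha j₀))

lemma abs_gridSum [NeZero M] {ψ : (Fin d → ℝ) → ℝ} (hψ : tsupport ψ ⊆ box d) (h0 : ∀ y, 0 ≤ ψ y)
    (a : (Fin d → Fin M) → ℝ) (x : Fin d → ℝ) :
    |gridSum M a ψ x| = gridSum M (fun j => |a j|) ψ x := by
  obtain ⟨j₀, h⟩ := exists_cell (M := M) x
  rw [gridSum_eq_single hψ h, gridSum_eq_single hψ h, abs_mul, abs_of_nonneg (h0 _)]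

lemma contDiff_cellMap (j : Fin d → Fin M) : ContDiff ℝ (⊤ : ℕ∞) (cellMap M j) :=
  (contDiff_id.const_smul _).sub contDiff_const

lemma contDiff_gridSum {ψ : (Fin d → ℝ) → ℝ} (hψ : ContDiff ℝ (⊤ : ℕ∞) ψ)
    (a : (Fin d → Fin M) → ℝ) : ContDiff ℝ (⊤ : ℕ∞) (gridSum M a ψ) :=
  ContDiff.sum fun j _ => contDiff_const.mul (hψ.comp (contDiff_cellMap j))

lemma partialDeriv_gridSum {ψ : (Fin d → ℝ) → ℝ} (hψ : ContDiff ℝ (⊤ : ℕ∞) ψ)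
    (a : (Fin d → Fin M) → ℝ) (i : Fin d) :
    partialDeriv i (gridSum M a ψ) = gridSum M (fun j => M * a j) (partialDeriv i ψ) := by
  ext x
  have hcell : ∀ j : Fin d → Fin M, HasFDerivAt (cellMap M j)
      ((M : ℝ) • ContinuousLinearMap.id ℝ (Fin d → ℝ)) x := fun j =>
    ((hasFDerivAt_id x).const_smul (M : ℝ)).sub_const _
  have h : HasFDerivAt (gridSum M a ψ) (∑ j, a j • (fderiv ℝ ψ (cellMap M j x)).comp
      ((M : ℝ) • ContinuousLinearMap.id ℝ (Fin d → ℝ))) x :=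
    HasFDerivAt.fun_sum fun j _ => (((hψ.differentiable (by simp) _).hasFDerivAt).comp x
      (hcell j)).const_mul (a j)
  simp only [partialDeriv, h.fderiv, gridSum]
  simp
  exact Finset.sum_congr rfl fun j _ => by ring

/-- Each derivative contributes a factor `M` by the chain rule and leaves a grid sum, so the
disjointness of the cells still applies. -/
lemma listDeriv_gridSum {ψ : (Fin d → ℝ) → ℝ} (hψ : ContDiff ℝ (⊤ : ℕ∞) ψ)
    (a : (Fin d → Fin M) → ℝ) (L : List (Fin d)) :
    listDeriv L (gridSum M a ψ) = gridSum M (fun j => (M : ℝ) ^ L.length * a j) (listDeriv L ψ) := by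
  induction L with
  | nil => simp [listDeriv]
  | cons i L ih =>
    change partialDeriv i (listDeriv L _) = _
    rw [ih, partialDeriv_gridSum (contDiff_listDeriv hψ L)]
    simp only [← mul_assoc, ← pow_succ', List.length_cons]
    rfl

lemma mem_Icc_of_cellMap_mem_box {j : Fin d → Fin M} {x : Fin d → ℝ} (h : cellMap M j x ∈ box d) :
    x ∈ Icc (0 : Fin d → ℝ) 1 := by
  have hM : ∀ i, (0 : ℝ) < M := fun i => by exact_mod_cast (j i).pos
  refine ⟨fun i => ?_, fun i => ?_⟩ <;> obtain ⟨h1, h2⟩ := h i <;>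
    simp only [cellMap, Pi.sub_apply, Pi.smul_apply, smul_eq_mul] at h1 h2
  · have h3 : (0 : ℝ) ≤ (j i : ℕ) := by positivity
    exact (pos_of_mul_pos_right (by linarith) (hM i).le).le
  · have h3 : ((j i : ℕ) : ℝ) + 1 ≤ M := by exact_mod_cast (j i).2
    change x i ≤ 1
    by_contra! hx
    nlinarith [hM i]

lemma integral_gridSum {ψ : (Fin d → ℝ) → ℝ} (hψ : Continuous ψ)
    (hs : tsupport ψ ⊆ box d) (a : (Fin d → Fin M) → ℝ) :
    ∫ x : Cube d, gridSum M a ψ x ∂cubeMeasure d = (∑ j, a j) * (((M : ℝ) ^ d)⁻¹ * ∫ y, ψ y) := by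
  have hcell : ∀ j : Fin d → Fin M, ∫ x : Cube d, ψ (cellMap M j x) ∂cubeMeasure d
      = ((M : ℝ) ^ d)⁻¹ * ∫ y, ψ y := by
    intro j
    rw [integral_cube_of_support_subset (h := fun x => ψ (cellMap M j x))]
    · unfold cellMap
      rw [Measure.integral_comp_smul volume (fun x => ψ (x - fun i => ((j i : ℕ) : ℝ))) (M : ℝ),
        integral_sub_right_eq_self]
      simp
    · exact fun x hx => mem_Icc_of_cellMap_mem_box (hs (subset_tsupport _ hx))
  unfold gridSum
  rw [integral_finsetSum, Finset.sum_mul]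
  · exact Finset.sum_congr rfl fun j _ => by rw [integral_const_mul, hcell]
  · intro j _
    refine Integrable.const_mul ?_ _
    exact (ContinuousMap.mk (fun x : Cube d => ψ (cellMap M j x)) (hψ.comp
      ((contDiff_cellMap j).continuous.comp continuous_subtype_val))).continuous.integrable_of_hasCompactSupport
        (HasCompactSupport.of_compactSpace _)

end Grid

/-! ### The lower bound -/

section LowerBound

/-- A smooth bump in the unit box. -/
def unitBump (d : ℕ) : ContDiffBump (fun _ => 1 / 2 : Fin d → ℝ) where
  rIn := 1 / 4
  -- Any outer radius below `1/2` keeps the closed sup-norm ball inside the open unit box.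
  rOut := 1 / 3
  rIn_pos := by norm_num
  rIn_lt_rOut := by norm_num

lemma tsupport_unitBump_subset (d : ℕ) : tsupport (unitBump d) ⊆ box d := by
  rw [ContDiffBump.tsupport_eq]
  intro y hy i
  have h := (dist_le_pi_dist y _ i).trans (Metric.mem_closedBall.1 hy)
  rw [Real.dist_eq, abs_le] at h
  simp only [unitBump] at h
  constructor <;> linarith [h.1, h.2]

/-- The finitely many relevant derivatives of the bump are bounded by compact support. It matters
that `κ` does not depend on the mesh. -/
lemma exists_scale (d r : ℕ) : ∃ κ : ℝ, 0 < κ ∧ ∀ α ∈ multiIndices d r, ∀ x,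
    κ * |listDeriv (directions α).reverse (unitBump d) x| ≤ 1 / (multiIndices d r).card := by
  have h : ∀ α : Fin d → ℕ, ∃ C, ∀ x, ‖listDeriv (directions α).reverse (unitBump d) x‖ ≤ C :=
    fun α => (hasCompactSupport_listDeriv (unitBump d).hasCompactSupport _).exists_bound_of_continuous
      (contDiff_listDeriv (unitBump d).contDiff _).continuous
  choose C hC using h
  have hC0 : ∀ α, 0 ≤ C α := fun α => (norm_nonneg _).trans (hC α 0)
  set T := ∑ α ∈ multiIndices d r, C α
  have hT : 0 ≤ T := Finset.sum_nonneg fun α _ => hC0 α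
  have hcard : (0 : ℝ) < (multiIndices d r).card := by exact_mod_cast multiIndices_card_pos d r
  refine ⟨1 / (multiIndices d r).card / (1 + T), by positivity, fun α hα x => ?_⟩
  have h1 : |listDeriv (directions α).reverse (unitBump d) x| ≤ 1 + T := by
    have := Finset.single_le_sum (fun α _ => hC0 α) hα
    have := hC α x
    rw [Real.norm_eq_abs] at this
    linarith
  calc _ ≤ 1 / (multiIndices d r).card / (1 + T) * (1 + T) := by gcongr
    _ = _ := by field_simp

/-- The fooling functions: bumps of height `A` on the cells, with signs given by a bit string. -/
def fooling (d M : ℕ) (A : ℝ) (ε : (Fin d → Fin M) → Bool) : (Fin d → ℝ) → ℝ :=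
  gridSum M (fun j => A * boolSign (ε j)) (unitBump d)

lemma abs_boolSign (b : Bool) : |boolSign b| = 1 := by cases b <;> simp [boolSign]

variable {d M : ℕ}

lemma contDiff_fooling (A : ℝ) (ε : (Fin d → Fin M) → Bool) :
    ContDiff ℝ (⊤ : ℕ∞) (fooling d M A ε) :=
  contDiff_gridSum (unitBump d).contDiff _

/-- The height `κ / M ^ r` pays for the factor `M ^ |α|` of a derivative of order `|α| ≤ r`, and
disjoint supports prevent accumulation over cells. -/
lemma fooling_mem_sobolevBall [NeZero M] {r : ℕ} {p : ℝ≥0∞} (hp : 1 ≤ p) {κ : ℝ} (hκ : 0 < κ)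
    (h : ∀ α ∈ multiIndices d r, ∀ x,
      κ * |listDeriv (directions α).reverse (unitBump d) x| ≤ 1 / (multiIndices d r).card)
    (ε : (Fin d → Fin M) → Bool) :
    (fun x : Cube d => fooling d M (κ / (M : ℝ) ^ r) ε x) ∈ sobolevBall d r p := by
  have hM : (1 : ℝ) ≤ M := by exact_mod_cast NeZero.one_le
  refine mem_sobolevBall_of_contDiff hp (contDiff_fooling _ ε) fun α hα x => ?_
  rw [fooling, listDeriv_gridSum (unitBump d).contDiff]
  refine (abs_gridSum_le (A := κ) (C := 1 / (multiIndices d r).card / κ)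
    ((tsupport_listDeriv_subset _ _).trans (tsupport_unitBump_subset d)) (fun j => ?_)
    (fun y => ?_) x).trans (by field_simp; rfl)
  · rw [abs_mul, abs_mul, abs_boolSign, mul_one, abs_of_nonneg (by positivity),
      abs_of_nonneg (by positivity), List.length_reverse, length_directions]
    have h1 : (M : ℝ) ^ (∑ i, α i) ≤ (M : ℝ) ^ r :=
      pow_le_pow_right₀ hM (Finset.mem_filter.1 hα).2
    rw [mul_div_left_comm]
    exact mul_le_of_le_one_right hκ.le (div_le_one_of_le₀ h1 (by positivity))
  · rw [le_div_iff₀ hκ, mul_comm]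
    exact h α hα y

lemma bitLocal_fooling [NeZero M] (A : ℝ) :
    BitLocal fun (ε : (Fin d → Fin M) → Bool) (x : Cube d) => fooling d M A ε x := by
  intro x
  obtain ⟨j₀, h⟩ := exists_cell (M := M) x.1
  refine ⟨j₀, fun ε ε' hε => ?_⟩
  simp only [fooling, gridSum_eq_single (tsupport_unitBump_subset d) h, hε]

/-- By disjointness of the supports the modulus passes to the coefficients; each differing sign
contributes `2 * A` times the integral of one scaled bump. -/
lemma integral_abs_fooling_sub [NeZero M] {A : ℝ} (hA : 0 ≤ A)
    (ε ε' : (Fin d → Fin M) → Bool) :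
    ∫ x : Cube d, |fooling d M A ε x - fooling d M A ε' x| ∂cubeMeasure d
      = 2 * A * hammingDist ε ε' * (((M : ℝ) ^ d)⁻¹ * ∫ y, unitBump d y) := by
  have h1 : ∀ x, |fooling d M A ε x - fooling d M A ε' x| =
      gridSum M (fun j => if ε j ≠ ε' j then 2 * A else 0) (unitBump d) x := by
    intro x
    have : fooling d M A ε x - fooling d M A ε' x =
        gridSum M (fun j => A * boolSign (ε j) - A * boolSign (ε' j)) (unitBump d) x := by
      simp only [fooling, gridSum, sub_mul, Finset.sum_sub_distrib]
    rw [this, abs_gridSum (tsupport_unitBump_subset d) fun y => (unitBump d).nonneg]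
    congr 1
    ext j
    cases ε j <;> cases ε' j <;> simp [boolSign]
    · rw [abs_of_nonpos (by linarith)]
      ring
    · rw [abs_of_nonneg (by linarith)]
      ring
  simp_rw [h1]
  rw [integral_gridSum (unitBump d).continuous (tsupport_unitBump_subset d),
    ← Finset.sum_filter, Finset.sum_const, nsmul_eq_mul, hammingDist]
  ring

/-- On a probability space `L_1` is dominated by `L_q`, so a single separation estimate in `L_1`
serves all `q`. -/
lemma integral_abs_sub_le_norm_toLp_sub (q : ℝ≥0∞) [Fact (1 ≤ q)] (f g : C(Cube d, ℝ)) :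
    ∫ x, |f x - g x| ∂cubeMeasure d ≤
      ‖ContinuousMap.toLp q (cubeMeasure d) ℝ f - ContinuousMap.toLp q (cubeMeasure d) ℝ g‖ := by
  rw [← map_sub]
  have hm : AEStronglyMeasurable (f - g) (cubeMeasure d) := (f - g).continuous.aestronglyMeasurable
  have hq : MemLp (f - g) q (cubeMeasure d) := by
    rw [← memLp_congr_ae (ContinuousMap.coeFn_toLp (p := q) (𝕜 := ℝ) (cubeMeasure d) (f - g))]
    exact Lp.memLp _
  rw [Lp.norm_def, eLpNorm_congr_ae (ContinuousMap.coeFn_toLp (𝕜 := ℝ) (cubeMeasure d) (f - g))]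
  have h1 : ∫ x, |f x - g x| ∂cubeMeasure d = (eLpNorm (f - g) 1 (cubeMeasure d)).toReal := by
    rw [eLpNorm_one_eq_lintegral_enorm, ← integral_norm_eq_lintegral_enorm hm]
    rfl
  rw [h1]
  exact ENNReal.toReal_mono hq.eLpNorm_ne_top
    (eLpNorm_le_eLpNorm_of_exponent_le Fact.out hm)

lemma Algorithm.prob_mono {D K G : Type} (A : Algorithm D K G) (f : D → K) {C C' : Set G}
    (h : C ⊆ C') : A.prob f C ≤ A.prob f C' := by
  unfold Algorithm.prob
  refine Finset.sum_le_sum fun x _ => ?_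
  have h0 : 0 ≤ A.outcomeProb f x := Finset.prod_nonneg fun _ _ => by positivity
  by_cases hx : A.φ x ∈ C
  · simp [hx, h hx]
  · simp only [hx, if_false]
    split_ifs <;> simp [h0]

/-- If the output misses the value at `f` by more than `η` with probability larger than `1/4`,
then the error is at least `η`. -/
lemma ofReal_le_algError {D K G : Type} [NormedAddCommGroup G] {F : Set (D → K)} (S : F → G)
    (A : Algorithm D K G) (f : F) {η : ℝ} (h : 1 / 4 < A.prob f.1 {g | η < ‖S f - g‖}) :
    ENNReal.ofReal η ≤ algError F S A := by
  refine le_iSup_of_le f (le_iInf₂ fun δ hδ => ?_)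
  rw [ENNReal.ofReal_le_coe]
  by_contra! hlt
  exact absurd (h.trans_le (A.prob_mono f.1 fun g hg => hlt.trans hg)) (not_lt.2 hδ)

lemma le_minError_of_grid [NeZero M] {p q : ℝ≥0∞} [Fact (1 ≤ p)] [Fact (1 ≤ q)] {r n : ℕ} {κ : ℝ}
    (hκ : 0 < κ) (h : ∀ α ∈ multiIndices d r, ∀ x,
      κ * |listDeriv (directions α).reverse (unitBump d) x| ≤ 1 / (multiIndices d r).card)
    (hn : 1 ≤ n) (hM : 16 * n ≤ M ^ d) :
    ENNReal.ofReal (κ * (∫ y, unitBump d y) / (16 * (M : ℝ) ^ r)) ≤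
      minError n (sobolevBall d r p) (sobolevEmbedding d r p q) := by
  refine le_iInf₂ fun A hA => ?_
  have hM0 : (0 : ℝ) < M := by exact_mod_cast NeZero.pos M
  set I := ∫ y, unitBump d y
  have hI : 0 < I := (unitBump d).integral_pos
  -- Chosen so that `2 * η` is the `L_1` distance corresponding to a fraction `1/16` of differing
  -- signs.
  set η := κ * I / (16 * (M : ℝ) ^ r) with hη
  let F : ((Fin d → Fin M) → Bool) → sobolevBall d r p := fun ε =>
    ⟨_, fooling_mem_sobolevBall Fact.out hκ h ε⟩
  have hcard : Fintype.card (Fin d → Fin M) = M ^ d := by simp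
  -- The same `k`, the integer part of `M ^ d / 16`, bounds the number of queries and the Hamming
  -- distance of patterns sharing an acceptable output.
  obtain ⟨ε, hε⟩ := A.recovery_bound (F := fun ε => (F ε).1) (bitLocal_fooling _)
    (k := M ^ d / 16) (by omega) (by omega) (by omega)
    (fun ε => {g | η < ‖sobolevEmbedding d r p q (F ε) - g‖}) (by
      intro g ε ε' h1 h2
      simp only [mem_ofPred_eq, not_lt] at h1 h2
      have h3 : ‖sobolevEmbedding d r p q (F ε) - sobolevEmbedding d r p q (F ε')‖ ≤ 2 * η := by
        have := norm_sub_le_norm_sub_add_norm_sub (sobolevEmbedding d r p q (F ε)) g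
          (sobolevEmbedding d r p q (F ε'))
        rw [norm_sub_rev g] at this
        linarith
      have h4 := (integral_abs_sub_le_norm_toLp_sub q _ _).trans h3
      change ∫ x : Cube d, |fooling d M (κ / (M : ℝ) ^ r) ε x - fooling d M (κ / (M : ℝ) ^ r) ε' x|
        ∂cubeMeasure d ≤ _ at h4
      rw [integral_abs_fooling_sub (by positivity)] at h4
      have h5 : (hammingDist ε ε' : ℝ) * 16 ≤ (M : ℝ) ^ d := by
        have e1 : 2 * (κ / (M : ℝ) ^ r) * hammingDist ε ε' * (((M : ℝ) ^ d)⁻¹ * I)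
            = 2 * η / (M : ℝ) ^ d * (hammingDist ε ε' * 16) := by
          rw [hη]
          field_simp
        change 2 * (κ / (M : ℝ) ^ r) * hammingDist ε ε' * (((M : ℝ) ^ d)⁻¹ * I) ≤ _ at h4
        have h6 : 2 * η / (M : ℝ) ^ d * (hammingDist ε ε' * 16) ≤
            2 * η / (M : ℝ) ^ d * (M : ℝ) ^ d := by
          rw [← e1, div_mul_cancel₀ _ (by positivity)]
          exact h4
        exact le_of_mul_le_mul_left h6 (by positivity)
      rw [Nat.le_div_iff_mul_le (by norm_num)]
      exact_mod_cast h5)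
  exact ofReal_le_algError _ A (F ε) hε

end LowerBound

end QuantumIBC

end

theorem corollary2 (p q : ℝ≥0∞) [Fact (1 ≤ p)] [Fact (1 ≤ q)] (r d : ℕ) (hr : 1 ≤ r) (hd : 1 ≤ d)
    (hrd : max (p⁻¹).toReal (2 * (p⁻¹).toReal - 2 * (q⁻¹).toReal) < (r : ℝ) / (d : ℝ)) :
    ∃ c : ℝ, 0 < c ∧ ∀ n : ℕ, 1 ≤ n →
      ENNReal.ofReal (c * (n : ℝ) ^ (-((r : ℝ) / (d : ℝ)))) ≤
        QuantumIBC.minError n (QuantumIBC.sobolevBall d r p)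
          (QuantumIBC.sobolevEmbedding d r p q) := by
  obtain ⟨κ, hκ, h⟩ := QuantumIBC.exists_scale d r
  have hI : 0 < ∫ y, QuantumIBC.unitBump d y := (QuantumIBC.unitBump d).integral_pos
  set I := ∫ y, QuantumIBC.unitBump d y
  have hd0 : (0 : ℝ) < d := by exact_mod_cast hd
  refine ⟨κ * I / (16 * (2 ^ r * (16 : ℝ) ^ ((r : ℝ) / d))), by positivity, fun n hn => ?_⟩
  have hn0 : (1 : ℝ) ≤ n := by exact_mod_cast hn
  -- The real mesh parameter with `t ^ d = 16 * n`; the grid uses `M = ⌈t⌉₊`.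
  set t : ℝ := (16 * n) ^ (1 / (d : ℝ)) with ht
  have ht1 : 1 ≤ t := Real.one_le_rpow (by linarith) (by positivity)
  have htd : t ^ d = 16 * n := by
    rw [ht, ← Real.rpow_natCast, ← Real.rpow_mul (by positivity), one_div_mul_cancel hd0.ne',
      Real.rpow_one]
  have htr : t ^ r = 16 ^ ((r : ℝ) / d) * (n : ℝ) ^ ((r : ℝ) / d) := by
    rw [ht, ← Real.rpow_natCast, ← Real.rpow_mul (by positivity), one_div_mul_eq_div,
      Real.mul_rpow (by norm_num) (by positivity)]
  have hle : t ≤ ⌈t⌉₊ := Nat.le_ceil t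
  have hM0 : ⌈t⌉₊ ≠ 0 := (Nat.ceil_pos.2 (by linarith)).ne'
  have : NeZero ⌈t⌉₊ := ⟨hM0⟩
  have hM : 16 * n ≤ ⌈t⌉₊ ^ d := by
    have : (16 * n : ℝ) ≤ (⌈t⌉₊ : ℝ) ^ d := by
      rw [← htd]
      gcongr
    exact_mod_cast this
  refine le_trans (ENNReal.ofReal_le_ofReal ?_)
    (QuantumIBC.le_minError_of_grid (p := p) (q := q) hκ h hn hM)
  -- Rounding up at most doubles `t` because `t ≥ 1`; this is the source of `2 ^ r` in the constant.
  have hM2 : (⌈t⌉₊ : ℝ) ≤ 2 * t := by linarith [Nat.ceil_lt_add_one (show 0 ≤ t by linarith)]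
  have hMr : (⌈t⌉₊ : ℝ) ^ r ≤ 2 ^ r * (16 ^ ((r : ℝ) / d) * (n : ℝ) ^ ((r : ℝ) / d)) := by
    rw [← htr, ← mul_pow]
    gcongr
  have hpos : (0 : ℝ) < (⌈t⌉₊ : ℝ) ^ r := by positivity
  calc κ * I / (16 * (2 ^ r * (16 : ℝ) ^ ((r : ℝ) / d))) * (n : ℝ) ^ (-((r : ℝ) / (d : ℝ)))
      = κ * I / (16 * (2 ^ r * (16 ^ ((r : ℝ) / d) * (n : ℝ) ^ ((r : ℝ) / d)))) := by
        rw [Real.rpow_neg (by positivity)]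
        field_simp
    _ ≤ κ * I / (16 * (⌈t⌉₊ : ℝ) ^ r) := by gcongr
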